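/- Let $\mathbb F$ be $\mathbb R$ or $\mathbb C$. Let $A$ be either (i) a CSL-algebra over $\mathbb F$, that is, $A=\mathrm{Alg}\,\mathcal L=\{T\in B(H): T(L)\subseteq L \text{ for all } L\in\mathcal L\}$ with the operator norm, where $H$ is a Hilbert space over $\mathbb F$ and $\mathcal L$ is a commutative subspace lattice on $H$ (a collection of closed subspaces of $H$ that contains $\{0\}$ and $H$, is closed under arbitrary intersections and arbitrary closed linear spans, and is such that the orthogonal projections onto its members commute pairwise); or (ii) a unital semisimple Banach algebra over $\mathbb F$, that is, a unital Banach algebra whose Jacobson radical is $\{0\}$. Let $\delta:A\to A$ be a continuous $\mathbb F$-linear map such that for all $a,b\in A$, $$ab+ba=\mathbf 1\ \Longrightarrow\ 2a\delta(b)+2b\delta(a)=\delta(\mathbf 1).$$ Then $\delta=0$. -/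

import Mathlib

/-- A subspace lattice on a Hilbert space `H`: a collection of closed subspaces that contains
`{0}` and `H` and is closed under arbitrary intersections and arbitrary closed linear spans.
In `ClosedSubmodule 𝕜 H`, `sInf` is the intersection and `sSup` is the closed linear span. -/
structure IsSubspaceLattice {𝕜 H : Type*} [RCLike 𝕜] [NormedAddCommGroup H]
    [InnerProductSpace 𝕜 H] (L : Set (ClosedSubmodule 𝕜 H)) : Prop where
  bot_mem : ⊥ ∈ L
  top_mem : ⊤ ∈ L
  sInf_mem : ∀ S ⊆ L, sInf S ∈ L
  sSup_mem : ∀ S ⊆ L, sSup S ∈ L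

/-- A commutative subspace lattice (CSL): a subspace lattice such that the orthogonal projections
of `H` onto its members commute with each other. -/
structure IsCSL {𝕜 H : Type*} [RCLike 𝕜] [NormedAddCommGroup H]
    [InnerProductSpace 𝕜 H] [CompleteSpace H] (L : Set (ClosedSubmodule 𝕜 H)) : Prop
    extends IsSubspaceLattice L where
  commute : ∀ M ∈ L, ∀ N ∈ L,
    Commute M.toSubmodule.starProjection N.toSubmodule.starProjection

/-- `Alg L`: the algebra of all bounded operators on `H` that leave every member of `L`
invariant. As a subalgebra of `H →L[𝕜] H` it carries the operator norm. -/
def latticeAlg {𝕜 H : Type*} [RCLike 𝕜] [NormedAddCommGroup H]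
    [InnerProductSpace 𝕜 H] (L : Set (ClosedSubmodule 𝕜 H)) : Subalgebra 𝕜 (H →L[𝕜] H) where
  carrier := {T | ∀ M ∈ L, ∀ x ∈ M, T x ∈ M}
  mul_mem' hS hT M hM x hx := hS M hM _ (hT M hM x hx)
  add_mem' hS hT M hM x hx := add_mem (hS M hM x hx) (hT M hM x hx)
  algebraMap_mem' c M hM x hx := by
    rw [Algebra.algebraMap_eq_smul_one]
    exact M.toSubmodule.smul_mem c hx

/-- The Jordan-left-derivation identity at pairs with `a * b + b * a = 1`. -/
def IsJordanLeftDerivableAtOne {A : Type*} [Ring A] (δ : A → A) : Prop :=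
  ∀ a b : A, a * b + b * a = 1 → 2 * a * δ b + 2 * b * δ a = δ 1

/-! Testing the hypothesis on `u` and `u⁻¹ / 2` for units `u = 1 - t • x` and letting `t → 0` gives
`δ (x * x) = 2 * x * δ x`. From then on only this identity, continuity and completeness matter, and
real scalars suffice. Write `[a, y] = a * y - y * a`.

Semisimple case: it is enough that `δ` maps into each maximal left ideal `M`. The identities `[a,
[a, y]] * δ a = 0` and `[a, y] ^ 2 * δ a = 0`, read in the simple module `A ⧸ M`, show that either
`δ` maps into `M` or all commutators kill `A ⧸ M`. Hence `δ` is central-valued, and a factorial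
estimate on `δ^[n] (a ^ n)` shows that `δ` leaves `M` invariant. In the second alternative `A ⧸ M`
is a field; if `e` inverts `δ x` modulo `M`, the bounded operator `y ↦ e * δ (x * y)` has the
eigenvalue `n + 1` at `x ^ n` for every `n`, which is absurd.

CSL case: if `u` and `u⁻¹` have contractive powers, `δ (u ^ (n + 1)) = (n + 1) * u ^ n * δ u` forces
`δ u = 0`. Cayley transforms, and their real and imaginary parts, extend this to skew-adjoint and
self-adjoint elements, hence to all elements whose adjoint stays in the algebra. For `P` the
projection onto a member of the lattice, the operators `P T (1 - P)` annihilate the values of `δ`.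
With `E` the projection onto their joint kernel, `δ x = E δ x = δ (E x E)`, and `E x E` commutes
with every `P`, so its adjoint is in the algebra and `δ x = 0`. -/

open Filter Topology

/-- An additive map with `δ (x ^ 2) = 2 x δ x`. -/
structure IsJordanLeftDerivation {A : Type*} [Ring A] (δ : A →+ A) : Prop where
  map_mul_self : ∀ x, δ (x * x) = 2 * x * δ x

/-! ### Division by nonzero integers in real algebras -/

section Torsion

variable {A : Type*} [Ring A] [Algebra ℝ A]

lemma eq_zero_of_natCast_mul {n : ℕ} (hn : n ≠ 0) {x : A} (h : (n : A) * x = 0) : x = 0 := by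
  have h1 : ((n : ℝ)⁻¹) • ((n : A) * x) = x := by
    rw [← nsmul_eq_mul, ← Nat.cast_smul_eq_nsmul ℝ, smul_smul, inv_mul_cancel₀, one_smul]
    exact_mod_cast hn
  rw [← h1, h, smul_zero]

lemma eq_zero_of_two_mul {x : A} (h : 2 * x = 0) : x = 0 :=
  eq_zero_of_natCast_mul two_ne_zero (by exact_mod_cast h)

lemma Ideal.mem_of_natCast_mul_mem {L : Ideal A} {n : ℕ} (hn : n ≠ 0) {x : A}
    (h : (n : A) * x ∈ L) : x ∈ L := by
  have h1 : algebraMap ℝ A ((n : ℝ)⁻¹) * ((n : A) * x) = x := by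
    rw [← Algebra.smul_def, ← nsmul_eq_mul, ← Nat.cast_smul_eq_nsmul ℝ, smul_smul,
      inv_mul_cancel₀, one_smul]
    exact_mod_cast hn
  rw [← h1]
  exact L.mul_mem_left _ h

lemma Ideal.mem_of_two_mul_mem {L : Ideal A} {x : A} (h : 2 * x ∈ L) : x ∈ L :=
  mem_of_natCast_mul_mem two_ne_zero (by exact_mod_cast h)

end Torsion

/-! ### Commutator identities for Jordan left derivations -/

namespace IsJordanLeftDerivation

variable {A : Type*} [Ring A] {δ : A →+ A} (hδ : IsJordanLeftDerivation δ)
include hδ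

lemma map_mul_add_mul (x y : A) : δ (x * y + y * x) = 2 * x * δ y + 2 * y * δ x := by
  have h := hδ.map_mul_self (x + y)
  have e : (x + y) * (x + y) = x * x + y * y + (x * y + y * x) := by noncomm_ring
  rw [e, map_add, map_add, hδ.map_mul_self, hδ.map_mul_self, map_add δ x y] at h
  linear_combination (norm := noncomm_ring) h

lemma map_one : δ 1 = 0 := by
  have := hδ.map_mul_self 1
  simp only [mul_one] at this
  linear_combination (norm := noncomm_ring) -this

variable [Algebra ℝ A]

lemma map_mul_of_commute {x y : A} (h : Commute x y) : δ (x * y) = x * δ y + y * δ x := by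
  have := hδ.map_mul_add_mul x y
  rw [← h.eq, map_add] at this
  refine sub_eq_zero.1 (eq_zero_of_two_mul ?_)
  linear_combination (norm := noncomm_ring) this

lemma map_pow_succ (x : A) (n : ℕ) : δ (x ^ (n + 1)) = (n + 1) * x ^ n * δ x := by
  induction n with
  | zero => simp
  | succ n ih =>
    rw [pow_succ', hδ.map_mul_of_commute (Commute.self_pow x (n + 1)), ih]
    have : x * (n + 1) = ((n : A) + 1) * x := by
      rw [mul_add, add_mul, (Nat.cast_commute n x).eq, one_mul, mul_one]
    push_cast
    rw [← mul_assoc, ← mul_assoc, this, mul_assoc _ x, ← pow_succ']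
    noncomm_ring

lemma map_mul_mul (x y : A) :
    δ (x * y * x) = x * x * δ y + 3 * x * y * δ x - y * x * δ x := by
  have h1 := hδ.map_mul_add_mul x (x * y + y * x)
  have h2 := hδ.map_mul_add_mul (x * x) y
  rw [hδ.map_mul_self] at h2
  have e : x * (x * y + y * x) + (x * y + y * x) * x
    = (x * x * y + y * (x * x)) + (x * y * x + x * y * x) := by noncomm_ring
  rw [e, map_add, h2, map_add, hδ.map_mul_add_mul x y] at h1
  refine sub_eq_zero.1 (eq_zero_of_two_mul ?_)
  linear_combination (norm := noncomm_ring) h1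

lemma map_mul_mul_add (x y z : A) :
    δ (x * y * z) + δ (z * y * x) = (x * z + z * x) * δ y + 3 * x * y * δ z + 3 * z * y * δ x
      - y * x * δ z - y * z * δ x := by
  have h := hδ.map_mul_mul (x + z) y
  have e : (x + z) * y * (x + z) = x * y * x + z * y * z + (x * y * z + z * y * x) := by
    noncomm_ring
  rw [e] at h
  simp only [map_add, hδ.map_mul_mul] at h
  linear_combination (norm := noncomm_ring) h

/-- With third factor `x * y`, the linearized triple identity evaluates `δ` on `(x * y) ^ 2` and on
`x * (y * y) * x`; both values are also known directly. -/
lemma commutator_mul_map_mul (x y : A) :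
    (x * y - y * x) * δ (x * y) = x * (x * y - y * x) * δ y + y * (x * y - y * x) * δ x := by
  have h1 := hδ.map_mul_mul_add x y (x * y)
  have h2 := hδ.map_mul_self (x * y)
  have h3 := hδ.map_mul_mul x (y * y)
  rw [hδ.map_mul_self] at h3
  have e : x * y * y * x = x * (y * y) * x := by noncomm_ring
  rw [h2, e, h3] at h1
  linear_combination (norm := noncomm_ring) -h1

lemma commutator_commutator_mul_map (x y : A) :
    (x * (x * y - y * x) - (x * y - y * x) * x) * δ x = 0 := by
  have h1 := hδ.commutator_mul_map_mul x y
  have h2 := hδ.commutator_mul_map_mul x (y + x)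
  simp only [mul_add, map_add, hδ.map_mul_self] at h2
  refine eq_zero_of_two_mul ?_
  linear_combination (norm := noncomm_ring) h1 - h2

lemma commutator_mul_map_commutator (x y : A) :
    (x * y - y * x) * δ (x * y - y * x) = 0 := by
  have h1 := hδ.commutator_mul_map_mul x y
  have h2 := hδ.commutator_mul_map_mul y x
  rw [map_sub]
  linear_combination (norm := noncomm_ring) h1 + h2

lemma commutator_mul_map_commutator_add (x y z : A) :
    (x * y - y * x) * δ (x * z - z * x) + (x * z - z * x) * δ (x * y - y * x) = 0 := by
  have h := hδ.commutator_mul_map_commutator x (y + z)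
  have e : x * (y + z) - (y + z) * x = (x * y - y * x) + (x * z - z * x) := by noncomm_ring
  rw [e, map_add, add_mul, mul_add, mul_add, hδ.commutator_mul_map_commutator,
    hδ.commutator_mul_map_commutator] at h
  linear_combination (norm := noncomm_ring) h

lemma commutator_commutator_mul_map_add (a y z : A) :
    (a * (z * y - y * z) - (z * y - y * z) * a + (z * (a * y - y * a) - (a * y - y * a) * z)) * δ a
      + (a * (a * y - y * a) - (a * y - y * a) * a) * δ z = 0 := by
  have h1 := hδ.commutator_commutator_mul_map (a + z) y
  have h2 := hδ.commutator_commutator_mul_map (a - z) y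
  have h3 := hδ.commutator_commutator_mul_map z y
  rw [map_add] at h1
  rw [map_sub] at h2
  refine eq_zero_of_two_mul ?_
  linear_combination (norm := noncomm_ring) h1 - h2 - 2 * h3

/-- With `x = [a, y]` and `v = [a, x]`, the linearizations yield `2 * x * x * δ a = v * δ x` and
also `2 * x * x * δ a = 3 * v * δ x`, so both products vanish. -/
lemma commutator_mul_commutator_mul_map (a y : A) :
    (a * y - y * a) * (a * y - y * a) * δ a = 0 := by
  obtain ⟨x, hx⟩ : ∃ x, x = a * y - y * a := ⟨_, rfl⟩
  obtain ⟨v, hv⟩ : ∃ v, v = a * x - x * a := ⟨_, rfl⟩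
  rw [← hx]
  have hvw : v * δ a = 0 := by
    rw [hv, hx]; exact hδ.commutator_commutator_mul_map a y
  have hxx : x * δ x = 0 := by
    rw [hx]; exact hδ.commutator_mul_map_commutator a y
  have hxv : x * δ v + v * δ x = 0 := by
    have := hδ.commutator_mul_map_commutator_add a y x
    rwa [← hx, ← hv] at this
  have hax : 2 * δ (a * x) = 2 * a * δ x + 2 * x * δ a + δ v := by
    have := hδ.map_mul_add_mul a x
    rw [map_add] at this
    rw [hv, map_sub]
    linear_combination (norm := noncomm_ring) this
  have hxax : x * δ (a * x) = 0 := by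
    have := hδ.commutator_mul_map_commutator_add a y (a * y)
    have e : a * (a * y) - a * y * a = a * x := by rw [hx]; noncomm_ring
    rw [← hx, e, mul_assoc, hxx, mul_zero, add_zero] at this
    exact this
  have h1 : v * y * δ a + v * δ x = 0 := by
    have := hδ.commutator_commutator_mul_map_add a y x
    rw [← hx, ← hv] at this
    have e : a * (x * y - y * x) - (x * y - y * x) * a + (x * x - x * x) = v * y - y * v := by
      rw [hv, sub_self, add_zero]
      have : x * (a * y - y * a) - (a * y - y * a) * x = 0 := by rw [← hx, sub_self]
      linear_combination (norm := noncomm_ring) this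
    rw [e] at this
    have h3 : y * (v * δ a) = 0 := by rw [hvw, mul_zero]
    linear_combination (norm := noncomm_ring) this + h3
  have h2 : v * y * δ a + 2 * (x * x * δ a) = 0 := by
    have := hδ.commutator_commutator_mul_map a (y * y)
    have e : a * (a * (y * y) - y * y * a) - (a * (y * y) - y * y * a) * a
        = v * y + 2 * (x * x) + y * v := by
      rw [hv, hx]; noncomm_ring
    rw [e] at this
    have h3 : y * (v * δ a) = 0 := by rw [hvw, mul_zero]
    linear_combination (norm := noncomm_ring) this - h3
  have h4 : 2 * x * a * δ x + 2 * (x * x * δ a) + x * δ v = 0 := by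
    have : x * (2 * δ (a * x)) = 2 * (x * δ (a * x)) := by noncomm_ring
    rw [hxax, hax] at this
    linear_combination (norm := noncomm_ring) this
  have h5 : x * a * δ x = - (v * δ x) := by
    have : a * (x * δ x) = 0 := by rw [hxx, mul_zero]
    rw [hv]
    linear_combination (norm := noncomm_ring) this
  have h6 : 2 * (2 * (x * x * δ a)) = 0 := by
    linear_combination (norm := noncomm_ring) 3 * h2 - 3 * h1 - h4 + 2 * h5 + hxv
  exact eq_zero_of_two_mul (eq_zero_of_two_mul h6)

end IsJordanLeftDerivation

/-! ### Maximal left ideals and inner derivations -/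

namespace Ideal

section Ring

variable {A : Type*} [Ring A]

lemma IsMaximal.exists_sub_mul_mem {L : Ideal A} (hL : L.IsMaximal) {s : A} (hs : s ∉ L) (x : A) :
    ∃ r, x - r * s ∈ L := by
  have h : L ⊔ span {s} = ⊤ := by
    refine hL.1.2 _ (lt_of_le_of_ne le_sup_left fun h ↦ hs ?_)
    rw [h]
    exact mem_sup_right (mem_span_singleton_self s)
  have hx : x ∈ L ⊔ span {s} := h ▸ Submodule.mem_top
  obtain ⟨l, hl, m, hm, rfl⟩ := Submodule.mem_sup.1 hx
  obtain ⟨r, rfl⟩ := mem_span_singleton'.1 hm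
  exact ⟨r, by simpa using hl⟩

/-- The class of `s ∉ L` generates the simple module `A ⧸ L`, so any `r` is congruent to some `t *
s`, and `p * r` to `p * t * s`. -/
lemma IsMaximal.mem_or_forall_mul_mem {L : Ideal A} (hL : L.IsMaximal) {p s : A}
    (h : ∀ r, p * r * s ∈ L) : s ∈ L ∨ ∀ r, p * r ∈ L := by
  refine or_iff_not_imp_left.2 fun hs r ↦ ?_
  obtain ⟨t, ht⟩ := hL.exists_sub_mul_mem hs r
  have := L.add_mem (L.mul_mem_left p ht) (h t)
  convert this using 1
  noncomm_ring

/-- The left ideal `{x | x * w ∈ M}`. -/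
def leftColon (M : Ideal A) (w : A) : Ideal A :=
  Submodule.comap (LinearMap.toSpanSingleton A A w) M

@[simp] lemma mem_leftColon {M : Ideal A} {w x : A} : x ∈ M.leftColon w ↔ x * w ∈ M := by
  simp [leftColon]

/-- The annihilator of a nonzero vector of a simple module is maximal. -/
lemma IsMaximal.leftColon {M : Ideal A} (hM : M.IsMaximal) {w : A} (hw : w ∉ M) :
    (M.leftColon w).IsMaximal := by
  refine Ideal.isMaximal_iff.2 ⟨by simpa using hw, fun J x hJ hx hxJ ↦ ?_⟩
  rw [mem_leftColon] at hx
  obtain ⟨r, hr⟩ := hM.exists_sub_mul_mem hx w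
  have : 1 - r * x ∈ J := hJ (by rw [mem_leftColon]; simpa [sub_mul, mul_assoc] using hr)
  simpa using J.add_mem this (J.mul_mem_left r hxJ)

end Ring

variable {A : Type*} [Ring A] [Algebra ℝ A]

/-- If `a` satisfies `[a, [a, y]] ∈ L` and `[a, y] ^ 2 ∈ L` for all `y`, where `L` is a maximal left
ideal, then all commutators `[a, y]` annihilate `A ⧸ L`. -/
lemma IsMaximal.commutator_mul_mem {L : Ideal A} (hL : L.IsMaximal) {a : A}
    (h₁ : ∀ y, a * (a * y - y * a) - (a * y - y * a) * a ∈ L)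
    (h₂ : ∀ y, (a * y - y * a) * (a * y - y * a) ∈ L) (y u : A) : (a * y - y * a) * u ∈ L := by
  obtain ⟨D, hD⟩ : ∃ D : A → A, D = fun y ↦ a * y - y * a := ⟨_, rfl⟩
  have hmul : ∀ y z, D (y * z) = D y * z + y * D z := fun y z ↦ by
    simp only [hD]; noncomm_ring
  have hadd : ∀ y z, D (y + z) = D y + D z := fun y z ↦ by
    simp only [hD]; noncomm_ring
  replace h₁ : ∀ y, D (D y) ∈ L := fun y ↦ by simpa only [hD] using h₁ y
  replace h₂ : ∀ y, D y * D y ∈ L := fun y ↦ by simpa only [hD] using h₂ y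
  suffices h : ∀ y u, D y * u ∈ L by simpa only [hD] using h y u
  clear hD
  have h₃ : ∀ y z, D (D y) * z + 2 * (D y * D z) ∈ L := fun y z ↦ by
    have := L.sub_mem (h₁ (y * z)) (L.mul_mem_left y (h₁ z))
    convert this using 1
    simp only [hmul, hadd]
    noncomm_ring
  have h₄ : ∀ y z, D (D y) * D z ∈ L := fun y z ↦ by
    have := L.sub_mem (h₃ y (D z)) (L.mul_mem_left (2 * D y) (h₁ z))
    convert this using 1
    noncomm_ring
  have h₅ : ∀ y z, D y * D z + D z * D y ∈ L := fun y z ↦ by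
    have := L.sub_mem (L.sub_mem (h₂ (y + z)) (h₂ y)) (h₂ z)
    convert this using 1
    simp only [hadd]
    noncomm_ring
  -- Use `h₃` at `z` and `u * D z`; `h₅` reverses `D z * D (u * D z)`, and then `h₂` and `h₄` absorb
  -- it.
  have h₆ : ∀ z u, D (D z) * u * D z ∈ L := fun z u ↦ by
    have e : D (D z) * u * D z = (D (D z) * (u * D z) + 2 * (D z * D (u * D z)))
        - 2 * (D z * D (u * D z) + D (u * D z) * D z)
        + 2 * (D u * (D z * D z) + u * (D (D z) * D z)) := by
      simp only [hmul]
      noncomm_ring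
    rw [e]
    exact L.add_mem (L.sub_mem (h₃ _ _) (L.mul_mem_left _ (h₅ _ _)))
      (L.mul_mem_left _ (L.add_mem (L.mul_mem_left _ (h₂ _)) (L.mul_mem_left _ (h₄ _ _))))
  -- By `h₆` each `y` lies in one of the additive subgroups `D y ∈ L` and `D (D y) * A ⊆ L`. A group
  -- is not the union of two proper subgroups.
  have h₇ : ∀ z u, D (D z) * u ∈ L := by
    by_contra! hcon
    obtain ⟨z, hz⟩ := hcon
    have hor : ∀ y, D y ∈ L ∨ ∀ u, D (D y) * u ∈ L := fun y ↦
      hL.mem_or_forall_mul_mem (h₆ y)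
    have hz' : ¬ ∀ u, D (D z) * u ∈ L := by simpa using hz
    have hzL : D z ∈ L := (hor z).resolve_right hz'
    have hall : ∀ y, D y ∈ L := fun y ↦ by
      rcases hor y with h | h
      · exact h
      · have : D (y + z) ∈ L := (hor (y + z)).resolve_right fun h' ↦ hz' fun u ↦ by
          have := L.sub_mem (h' u) (h u)
          convert this using 1
          simp only [hadd]
          noncomm_ring
        have := L.sub_mem this hzL
        rwa [hadd, add_sub_cancel_right] at this
    refine hz' fun u ↦ ?_
    have := L.sub_mem (h₃ z u) (L.mul_mem_left (2 * D z) (hall u))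
    convert this using 1
    noncomm_ring
  have h₈ : ∀ y z u, D y * D z * u ∈ L := fun y z u ↦ by
    refine mem_of_two_mul_mem ?_
    have := L.sub_mem (L.sub_mem (h₇ (y * z) u) (h₇ y (z * u))) (L.mul_mem_left y (h₇ z u))
    convert this using 1
    simp only [hmul, hadd]
    noncomm_ring
  have h₉ : ∀ y z u v, D y * z * (D u * v) ∈ L := fun y z u v ↦ by
    have := L.sub_mem (h₈ y (z * u) v) (h₈ y z (u * v))
    convert this using 1
    simp only [hmul]
    noncomm_ring
  intro y u
  by_contra hcon
  exact hcon ((hL.mem_or_forall_mul_mem fun r ↦ h₉ y r y u).elim id fun h ↦ h u)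

end Ideal

/-! ### Jordan left derivations modulo maximal left ideals -/

namespace IsJordanLeftDerivation

variable {A : Type*} [Ring A] [Algebra ℝ A] {δ : A →+ A} (hδ : IsJordanLeftDerivation δ)
include hδ

/-- The annihilator of the class of `δ a` in `A ⧸ M` is a maximal left ideal containing `[a, [a,
y]]` and `[a, y] ^ 2`. -/
lemma commutator_mul_mem_of_map_notMem {M : Ideal A} (hM : M.IsMaximal) {a : A} (ha : δ a ∉ M)
    (y u : A) : (a * y - y * a) * u ∈ M := by
  have hL := hM.leftColon ha
  have h := hL.commutator_mul_mem
    (fun y ↦ by rw [Ideal.mem_leftColon, hδ.commutator_commutator_mul_map]; exact M.zero_mem)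
    (fun y ↦ by rw [Ideal.mem_leftColon, hδ.commutator_mul_commutator_mul_map]; exact M.zero_mem) y
  refine (hM.mem_or_forall_mul_mem fun r ↦ ?_).resolve_left ha u
  exact Ideal.mem_leftColon.1 (h r)

/-- For each maximal left ideal `M`, either a Jordan left derivation takes values in `M` or all
commutators annihilate `A ⧸ M`. -/
lemma map_mem_or_commutator_mul_mem {M : Ideal A} (hM : M.IsMaximal) :
    (∀ x, δ x ∈ M) ∨ ∀ x y u, (x * y - y * x) * u ∈ M := by
  refine or_iff_not_imp_left.2 fun h x y u ↦ ?_
  push Not at h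
  obtain ⟨a, ha⟩ := h
  -- If `δ x ∈ M`, then `x` is the difference of `x + a` and `a`, whose values both lie outside `M`.
  by_cases hx : δ x ∈ M
  · have h1 := hδ.commutator_mul_mem_of_map_notMem hM (a := x + a)
      (by rwa [map_add, M.add_mem_iff_right hx]) y u
    have h2 := hδ.commutator_mul_mem_of_map_notMem hM ha y u
    convert M.sub_mem h1 h2 using 1
    noncomm_ring
  · exact hδ.commutator_mul_mem_of_map_notMem hM hx y u

/-- A Jordan left derivation of a semisimple algebra is central-valued. -/
lemma commute_map (hA : Ring.jacobson A = ⊥) (x y : A) : Commute (δ y) x := by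
  refine sub_eq_zero.1 ?_
  rw [← Ideal.mem_bot, ← hA, Ring.jacobson_eq_sInf_isMaximal, Submodule.mem_sInf]
  intro (M : Ideal A) (hM : M.IsMaximal)
  rcases hδ.map_mem_or_commutator_mul_mem hM with h | h
  · refine M.sub_mem ?_ (M.mul_mem_left _ (h y))
    by_cases hx : x ∈ M
    · exact M.mul_mem_left _ hx
    rcases hδ.map_mem_or_commutator_mul_mem (hM.leftColon hx) with h' | h'
    · exact Ideal.mem_leftColon.1 (h' y)
    -- `[δ y, x]` kills all multiples of the nonzero class of `x`, hence all of `A ⧸ M`.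
    · have h1 := (hM.mem_or_forall_mul_mem (p := δ y * x - x * δ y) fun r ↦
        Ideal.mem_leftColon.1 (h' (δ y) x r)).resolve_left hx 1
      convert M.add_mem h1 (M.mul_mem_left x (h y)) using 1
      noncomm_ring
  · simpa using h (δ y) x 1

end IsJordanLeftDerivation

/-! ### From Jordan product one to Jordan left derivations -/

section Unital

variable {A : Type*} [NormedRing A] [NormedAlgebra ℝ A]

lemma IsJordanLeftDerivableAtOne.mul_self_mul_map_inv {δ : A →L[ℝ] A}
    (hδ : IsJordanLeftDerivableAtOne δ) (h1 : δ 1 = 0) (u : Aˣ) :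
    (u : A) * u * δ ↑u⁻¹ = - δ u := by
  have h := hδ u ((1 / 2 : ℝ) • (↑u⁻¹ : A)) (by
    rw [mul_smul_comm, smul_mul_assoc, Units.mul_inv, Units.inv_mul, ← add_smul]
    norm_num)
  rw [h1, map_smul, mul_smul_comm, mul_smul_comm, smul_mul_assoc, ← smul_add,
    smul_eq_zero_iff_right (by norm_num)] at h
  have h2 : (u : A) * δ ↑u⁻¹ + ↑u⁻¹ * δ u = 0 := by
    refine eq_zero_of_two_mul ?_
    linear_combination (norm := noncomm_ring) h
  have h3 : (u : A) * (↑u⁻¹ * δ u) = δ u := by rw [← mul_assoc, Units.mul_inv, one_mul]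
  have h4 : (u : A) * (u * δ ↑u⁻¹ + ↑u⁻¹ * δ u) = 0 := by rw [h2, mul_zero]
  linear_combination (norm := noncomm_ring) h4 - h3

lemma IsJordanLeftDerivableAtOne.map_one {δ : A →L[ℝ] A}
    (hδ : IsJordanLeftDerivableAtOne δ) : δ 1 = 0 := by
  have h := hδ 1 ((1 / 2 : ℝ) • 1) (by
    rw [one_mul, mul_one, ← add_smul]; norm_num)
  rw [map_smul, mul_one, mul_smul_comm, mul_smul_comm, smul_mul_assoc, mul_one, ← smul_add] at h
  have h2 : (1 / 2 : ℝ) • (2 * δ 1 + 2 * δ 1) = 2 * δ 1 := by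
    rw [smul_add, ← add_smul]; norm_num
  rw [h2] at h
  linear_combination (norm := noncomm_ring) h

/-- A continuous linear map that satisfies the Jordan left derivation identity on pairs with
Jordan product `1` is a Jordan left derivation. -/
theorem IsJordanLeftDerivableAtOne.isJordanLeftDerivation [CompleteSpace A] {δ : A →L[ℝ] A}
    (hδ : IsJordanLeftDerivableAtOne δ) : IsJordanLeftDerivation (δ : A →+ A) := by
  have hδ1 := hδ.map_one
  refine ⟨fun x ↦ ?_⟩
  change δ (x * x) = 2 * x * δ x
  -- The inverse `u t` equals `1 + t x + t² x² u t`. Inserted into the relation between `δ v` and `δ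
  -- v⁻¹` for `v = 1 - t x`, it makes the lower-order terms cancel; `key` is what is left after
  -- division by `t²`.
  obtain ⟨u, hu⟩ : ∃ u : ℝ → A, u = fun t ↦ Ring.inverse (1 - t • x) := ⟨_, rfl⟩
  have hv : Tendsto (fun t : ℝ ↦ 1 - t • x) (𝓝 0) (𝓝 (1 : A)) := by
    have : Continuous fun t : ℝ ↦ 1 - t • x := by fun_prop
    simpa using this.tendsto 0
  have hlim : Tendsto u (𝓝 0) (𝓝 1) := by
    have h := (NormedRing.inverse_continuousAt (1 : Aˣ)).tendsto
    rw [Units.val_one, Ring.inverse_one] at h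
    rw [hu]
    exact h.comp hv
  have hunit : ∀ᶠ t : ℝ in 𝓝 0, IsUnit (1 - t • x) :=
    hv.eventually (Units.nhds (1 : Aˣ))
  have key : ∀ᶠ t : ℝ in 𝓝[≠] 0,
      δ (x * x * u t) = 2 * x * δ x + t • (2 * x * δ (x * x * u t)) - x * x * δ (u t) := by
    filter_upwards [hunit.filter_mono nhdsWithin_le_nhds, self_mem_nhdsWithin] with t ht ht0
    obtain ⟨v, hvt⟩ := ht
    have hut : u t = ↑v⁻¹ := by rw [hu]; simp only; rw [← hvt, Ring.inverse_unit]
    have h1 := hδ.mul_self_mul_map_inv hδ1 v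
    have h2 : u t = 1 + t • x + (t * t) • (x * x * u t) := by
      have : (1 - t • x) * u t = 1 := by rw [hut, ← hvt, Units.mul_inv]
      have h3 : u t = 1 + t • (x * u t) := by
        rw [sub_mul, one_mul, smul_mul_assoc, sub_eq_iff_eq_add] at this
        exact this
      conv_lhs => rw [h3, h3]
      simp only [mul_add, mul_one, smul_add, mul_smul_comm, smul_smul, mul_assoc, add_assoc]
    have h3 : δ (u t) = t • δ x + (t * t) • δ (x * x * u t) := by
      conv_lhs => rw [h2]
      simp only [map_add, map_smul, hδ1, zero_add]
    rw [← hut, hvt, map_sub, hδ1, map_smul] at h1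
    have h4 : δ (u t) = t • δ x + (2 * t) • (x * δ (u t)) - (t * t) • (x * x * δ (u t)) := by
      simp only [sub_mul, mul_sub, one_mul, mul_one, smul_mul_assoc, mul_smul_comm,
        mul_assoc] at h1 ⊢
      rw [two_mul, add_smul]
      linear_combination (norm := module) h1
    have h5 : (t * t) • δ (x * x * u t)
        = (t * t) • (2 * x * δ x + t • (2 * x * δ (x * x * u t)) - x * x * δ (u t)) := by
      have h6 : (2 * t) • (x * δ (u t))
          = (t * t) • (2 * x * δ x + t • (2 * x * δ (x * x * u t))) := by
        rw [h3]
        simp only [mul_assoc, two_mul, add_mul, mul_add, mul_smul_comm, smul_add, smul_smul]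
        module
      rw [smul_sub, ← h6]
      linear_combination (norm := module) h4 - h3
    exact smul_right_injective A (mul_ne_zero ht0 ht0) h5
  have hL : Tendsto (fun t ↦ δ (x * x * u t)) (𝓝[≠] 0) (𝓝 (δ (x * x))) := by
    have : Tendsto (fun t ↦ δ (x * x * u t)) (𝓝 0) (𝓝 (δ (x * x * 1))) :=
      (δ.continuous.tendsto _).comp (tendsto_const_nhds.mul hlim)
    rw [mul_one] at this
    exact this.mono_left nhdsWithin_le_nhds
  have hid : Tendsto (fun t : ℝ ↦ t) (𝓝[≠] 0) (𝓝 0) := tendsto_id.mono_left nhdsWithin_le_nhds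
  have hδu : Tendsto (fun t ↦ δ (u t)) (𝓝[≠] 0) (𝓝 (δ 1)) :=
    ((δ.continuous.tendsto _).comp hlim).mono_left nhdsWithin_le_nhds
  have hR := ((tendsto_const_nhds (x := 2 * x * δ x)).add
    (hid.smul ((tendsto_const_nhds (x := 2 * x)).mul hL))).sub
    ((tendsto_const_nhds (x := x * x)).mul hδu)
  rw [hδ1, mul_zero, zero_smul, add_zero, sub_zero] at hR
  exact tendsto_nhds_unique (hL.congr' key) hR

end Unital

/-! ### Semisimple Banach algebras -/

section Semisimple

namespace IsJordanLeftDerivation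

section Algebraic

variable {A : Type*} [Ring A] [Algebra ℝ A] {δ : A →+ A} (hδ : IsJordanLeftDerivation δ)
  (hc : ∀ x y, Commute (δ y) x) {M : Ideal A}
include hδ hc

/-- In the Leibniz expansion every other term contains some `δ^[i] y` with `i < n`. -/
lemma iterate_central_mul_sub_mem (n : ℕ) {c y : A} (hcc : ∀ x, Commute c x)
    (hy : ∀ i < n, δ^[i] y ∈ M) : δ^[n] (c * y) - c * δ^[n] y ∈ M := by
  induction n generalizing c y with
  | zero => simp
  | succ n ih =>
    have h1 := ih hcc (y := δ y) fun i hi ↦ hy (i + 1) (by omega)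
    have h2 := ih (hc · c) (y := y) fun i hi ↦ hy i (by omega)
    have h3 := M.mul_mem_left (δ c) (hy n (by omega))
    rw [Function.iterate_succ_apply, Function.iterate_succ_apply, hδ.map_mul_of_commute (hcc y),
      iterate_map_add, ← (hc y c).eq]
    convert M.add_mem (M.add_mem h1 h2) h3 using 1
    abel

lemma iterate_mul_sub_mem {a : A} (ha : a ∈ M) (n : ℕ) {y : A} (hay : Commute a y)
    (hy : ∀ i < n, δ^[i] y ∈ M) :
    δ^[n + 1] (a * y) - (n + 1) * (δ a * δ^[n] y) ∈ M := by
  induction n generalizing y with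
  | zero =>
    have := M.mul_mem_left (δ y) ha
    rw [(hc a y).eq] at this
    convert this using 1
    simp [hδ.map_mul_of_commute hay, (hc y a).eq]
  | succ n ih =>
    have h1 := ih (hc a y).symm fun i hi ↦ hy (i + 1) (by omega)
    have h2 := hδ.iterate_central_mul_sub_mem hc (n + 1) (hc · a) hy
    rw [Function.iterate_succ_apply, hδ.map_mul_of_commute hay, iterate_map_add, ← (hc y a).eq]
    convert M.add_mem h1 h2 using 1
    rw [Function.iterate_succ_apply (f := δ) (n := n) (x := y)]
    push_cast
    noncomm_ring

/-- Modulo `M` only the terms that differentiate each factor `a` exactly once survive, and there are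
`n!` of them. -/
lemma iterate_pow_sub_mem {a : A} (ha : a ∈ M) (n : ℕ) :
    (∀ i < n, δ^[i] (a ^ n) ∈ M) ∧ δ^[n] (a ^ n) - n.factorial * δ a ^ n ∈ M := by
  induction n with
  | zero => simp
  | succ n ih =>
    rw [pow_succ']
    refine ⟨fun i hi ↦ ?_, ?_⟩
    · cases i with
      | zero =>
        rw [Function.iterate_zero_apply, (Commute.self_pow a n).eq]
        exact M.mul_mem_left _ ha
      | succ i =>
        have h := hδ.iterate_mul_sub_mem hc ha i (Commute.self_pow a n)
          fun j hj ↦ ih.1 j (by omega)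
        have h1 : ((i : A) + 1) * (δ a * δ^[i] (a ^ n)) ∈ M :=
          M.mul_mem_left _ (M.mul_mem_left _ (ih.1 i (by omega)))
        simpa using M.add_mem h h1
    · have h := hδ.iterate_mul_sub_mem hc ha n (Commute.self_pow a n) ih.1
      have h1 := M.mul_mem_left (((n + 1 : ℕ) : A) * δ a) ih.2
      convert M.add_mem h h1 using 1
      have : δ a * (n.factorial * δ a ^ n) = n.factorial * δ a ^ (n + 1) := by
        rw [← mul_assoc, ← (Nat.cast_commute n.factorial (δ a)).eq, mul_assoc, ← pow_succ']
      rw [mul_sub, mul_assoc _ (δ a) (_ * _), this, Nat.factorial_succ]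
      push_cast
      noncomm_ring

end Algebraic

variable {A : Type*} [NormedRing A] [NormedAlgebra ℝ A] [CompleteSpace A] {δ : A →L[ℝ] A}

omit [CompleteSpace A] in
lemma norm_iterate_le (δ : A →L[ℝ] A) (n : ℕ) (x : A) : ‖δ^[n] x‖ ≤ ‖δ‖ ^ n * ‖x‖ := by
  induction n with
  | zero => simp
  | succ n ih =>
    rw [Function.iterate_succ_apply', pow_succ', mul_assoc]
    exact (δ.le_opNorm _).trans (by gcongr)

omit [NormedAlgebra ℝ A] in
lemma _root_.Ideal.one_le_norm_of_one_sub_mem {M : Ideal A} (hM : M ≠ ⊤) {x : A}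
    (h : 1 - x ∈ M) : 1 ≤ ‖x‖ := by
  by_contra! hx
  exact hM (M.eq_top_of_isUnit_mem h (Units.oneSub x hx).isUnit)

/-- A continuous central-valued Jordan left derivation leaves maximal left ideals invariant. -/
lemma map_mem_of_mem (hδ : IsJordanLeftDerivation (δ : A →+ A)) (hc : ∀ x y, Commute (δ y) x)
    {M : Ideal A} (hM : M.IsMaximal) {a : A} (ha : a ∈ M) : δ a ∈ M := by
  by_contra hcon
  obtain ⟨e, he⟩ := hM.exists_sub_mul_mem hcon 1
  have hpow : ∀ n : ℕ, 1 - e ^ n * δ a ^ n ∈ M := fun n ↦ by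
    induction n with
    | zero => simp
    | succ n ih =>
      have h1 := M.add_mem (M.mul_mem_left (e * δ a) ih) he
      convert h1 using 1
      have : e * e ^ n * (δ a * δ a ^ n) = e * δ a * (e ^ n * δ a ^ n) := by
        rw [mul_assoc, ← mul_assoc (e ^ n), ← (hc (e ^ n) a).eq]
        noncomm_ring
      rw [pow_succ', pow_succ', this]
      noncomm_ring
  -- Thus `1` is congruent modulo `M` to elements of norm at most `C ^ n / n!`, which tends to `0`;
  -- but elements congruent to `1` modulo a proper left ideal have norm at least `1`.
  have hmem : ∀ n : ℕ, 1 - (n.factorial : ℝ)⁻¹ • (e ^ n * δ^[n] (a ^ n)) ∈ M := fun n ↦ by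
    have h1 := M.mul_mem_left (e ^ n) (hδ.iterate_pow_sub_mem hc ha n).2
    have h2 := M.mul_mem_left (algebraMap ℝ A (n.factorial : ℝ)⁻¹) h1
    rw [← Algebra.smul_def] at h2
    convert M.sub_mem (hpow n) h2 using 1
    have h3 : (n.factorial : ℝ)⁻¹ • (e ^ n * ((n.factorial : A) * δ a ^ n)) = e ^ n * δ a ^ n := by
      rw [← mul_assoc, ← (Nat.cast_commute n.factorial (e ^ n)).eq, mul_assoc, ← nsmul_eq_mul,
        ← Nat.cast_smul_eq_nsmul ℝ, smul_smul, inv_mul_cancel₀, one_smul]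
      exact_mod_cast n.factorial_ne_zero
    change _ = _ - (n.factorial : ℝ)⁻¹ • (e ^ n * (δ^[n] (a ^ n) - _))
    rw [mul_sub, smul_sub]
    change _ = _ - (_ - (n.factorial : ℝ)⁻¹ • (e ^ n * ((n.factorial : A) * δ a ^ n)))
    rw [h3]
    abel
  -- The case `n = 0` is left out because `‖1‖ = 1` is not assumed.
  have hle : ∀ n : ℕ, 0 < n → 1 ≤ (‖e‖ * ‖δ‖ * ‖a‖) ^ n / n.factorial := fun n hn ↦ by
    refine (Ideal.one_le_norm_of_one_sub_mem hM.ne_top (hmem n)).trans ?_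
    rw [norm_smul, norm_inv, Real.norm_natCast, inv_mul_eq_div]
    gcongr
    calc ‖e ^ n * δ^[n] (a ^ n)‖ ≤ ‖e ^ n‖ * ‖δ^[n] (a ^ n)‖ := norm_mul_le _ _
      _ ≤ ‖e‖ ^ n * (‖δ‖ ^ n * ‖a‖ ^ n) := by
        gcongr
        · exact norm_pow_le' e hn
        · exact (norm_iterate_le δ n _).trans (by gcongr; exact norm_pow_le' a hn)
      _ = (‖e‖ * ‖δ‖ * ‖a‖) ^ n := by rw [mul_pow, mul_pow, mul_assoc]
  have hlim := FloorSemiring.tendsto_pow_div_factorial_atTop (‖e‖ * ‖δ‖ * ‖a‖)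
  have := ge_of_tendsto hlim (eventually_atTop.2 ⟨1, fun n hn ↦ hle n hn⟩)
  norm_num at this

omit [NormedAlgebra ℝ A] [CompleteSpace A] in
lemma _root_.Ideal.norm_mk_map_le {M : Ideal A} {f : A →+ A} {K : ℝ} (hK : 0 ≤ K)
    (hf : ∀ x, ‖f x‖ ≤ K * ‖x‖) (hM : ∀ x ∈ M, f x ∈ M) (x : A) :
    ‖(Submodule.Quotient.mk (f x) : A ⧸ M)‖ ≤ K * ‖(Submodule.Quotient.mk x : A ⧸ M)‖ := by
  refine le_of_forall_pos_le_add fun ε hε ↦ ?_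
  obtain ⟨y, hy, hyn⟩ := Submodule.Quotient.norm_mk_lt
    (S := M) (Submodule.Quotient.mk x) (ε := ε / (K + 1)) (by positivity)
  have h : (Submodule.Quotient.mk (f x) : A ⧸ M) = Submodule.Quotient.mk (f y) := by
    rw [Submodule.Quotient.eq, ← map_sub]
    exact hM _ ((Submodule.Quotient.eq M).1 hy.symm)
  rw [h]
  calc _ ≤ ‖f y‖ := Submodule.Quotient.norm_mk_le M _
    _ ≤ K * ‖y‖ := hf y
    _ ≤ K * (‖(Submodule.Quotient.mk x : A ⧸ M)‖ + ε / (K + 1)) := by gcongr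
    _ ≤ _ := by
      rw [mul_add]
      gcongr
      rw [mul_div_assoc', div_le_iff₀ (by positivity)]
      nlinarith

lemma map_mem_of_commutator_mul_mem (hδ : IsJordanLeftDerivation (δ : A →+ A))
    (hc : ∀ x y, Commute (δ y) x) {M : Ideal A} (hM : M.IsMaximal)
    (h : ∀ x y u, (x * y - y * x) * u ∈ M) (x : A) :
    δ x ∈ M := by
  have hinv : ∀ y ∈ M, δ y ∈ M := fun y hy ↦ hδ.map_mem_of_mem hc hM hy
  by_contra hcon
  have hx : x ∉ M := fun hx ↦ hcon (hinv x hx)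
  have hr : ∀ m ∈ M, ∀ r, m * r ∈ M := fun m hm r ↦ by
    convert M.add_mem (M.mul_mem_left r hm) (h m r 1) using 1
    noncomm_ring
  have hprime : ∀ p s, p * s ∈ M → s ∉ M → p ∈ M := fun p s hps hs ↦ by
    obtain ⟨r, hr⟩ := hM.exists_sub_mul_mem hs 1
    have h1 := M.add_mem (M.mul_mem_left r hps) (h p r s)
    convert M.add_mem (M.mul_mem_left p hr) h1 using 1
    noncomm_ring
  have hpow : ∀ n : ℕ, x ^ n ∉ M := fun n ↦ by
    induction n with
    | zero => rw [pow_zero]; exact fun h1 ↦ hM.ne_top ((Ideal.eq_top_iff_one M).2 h1)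
    | succ n ih => exact fun h1 ↦ ih (hprime _ _ (pow_succ x n ▸ h1) hx)
  obtain ⟨e, he⟩ := hM.exists_sub_mul_mem hcon 1
  have : M.IsMaximal := hM
  obtain ⟨K, hK⟩ : ∃ K, K = ‖e‖ * ‖δ‖ * ‖x‖ := ⟨_, rfl⟩
  have hK0 : 0 ≤ K := by rw [hK]; positivity
  have hle : ∀ n : ℕ, (n : ℝ) + 1 ≤ K := fun n ↦ by
    have hpos : 0 < ‖(Submodule.Quotient.mk (x ^ n) : A ⧸ M)‖ := by
      rw [norm_pos_iff, Ne, Submodule.Quotient.mk_eq_zero]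
      exact hpow n
    -- On `A ⧸ M` this map is bounded by `K`, whereas the nonzero class of `x ^ n` is an eigenvector
    -- with eigenvalue `n + 1`.
    let f : A →+ A := (AddMonoidHom.mulLeft e).comp ((δ : A →+ A).comp (AddMonoidHom.mulLeft x))
    have hfx : ∀ y, f y = e * δ (x * y) := fun _ ↦ rfl
    have h1 := Ideal.norm_mk_map_le (M := M) (f := f) hK0 (fun y ↦ by
        rw [hfx, hK]
        calc _ ≤ ‖e‖ * ‖δ (x * y)‖ := norm_mul_le _ _
          _ ≤ ‖e‖ * (‖δ‖ * (‖x‖ * ‖y‖)) := by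
            gcongr
            exact (δ.le_opNorm _).trans (by gcongr; exact norm_mul_le _ _)
          _ = _ := by ring)
      (fun y hy ↦ M.mul_mem_left _ (hinv _ (M.mul_mem_left _ hy))) (x ^ n)
    have h2 : (Submodule.Quotient.mk (f (x ^ n)) : A ⧸ M)
        = ((n : ℝ) + 1) • Submodule.Quotient.mk (x ^ n) := by
      rw [← Submodule.Quotient.mk_smul, Submodule.Quotient.eq, hfx, ← pow_succ']
      have h3 : δ (x ^ (n + 1)) = (n + 1) * x ^ n * δ x := hδ.map_pow_succ x n
      have h4 : ((n : ℝ) + 1) • x ^ n = (n + 1) * x ^ n := by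
        rw [Algebra.smul_def]; simp
      rw [h3, h4]
      have h5 := M.sub_mem (h e ((n + 1) * x ^ n) (δ x)) (M.mul_mem_left ((n + 1) * x ^ n) he)
      convert h5 using 1
      noncomm_ring
    rw [h2, norm_smul, Real.norm_of_nonneg (by positivity)] at h1
    exact le_of_mul_le_mul_right h1 hpos
  obtain ⟨n, hn⟩ := exists_nat_gt K
  linarith [hle n]

/-- A continuous Jordan left derivation of a semisimple Banach algebra is zero. -/
theorem eq_zero_of_jacobson_eq_bot (hA : Ring.jacobson A = ⊥)
    (hδ : IsJordanLeftDerivation (δ : A →+ A)) : δ = 0 := by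
  have hc : ∀ x y, Commute (δ y) x := hδ.commute_map hA
  ext x
  change δ x = 0
  rw [← Ideal.mem_bot, ← hA, Ring.jacobson_eq_sInf_isMaximal, Submodule.mem_sInf]
  intro (M : Ideal A) (hM : M.IsMaximal)
  exact (hδ.map_mem_or_commutator_mul_mem hM).elim (fun h ↦ h x)
    fun h ↦ hδ.map_mem_of_commutator_mul_mem hc hM h x

end IsJordanLeftDerivation

end Semisimple

/-! ### Powers of rotations without an imaginary unit -/

section Rotation

variable {A : Type*} [Ring A]

/-- The real and imaginary part of `(c + i s) ^ n`, for commuting `c` and `s`. -/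
def rotationPow (c s : A) : ℕ → A × A
  | 0 => (1, 0)
  | n + 1 => ((rotationPow c s n).1 * c - (rotationPow c s n).2 * s,
      (rotationPow c s n).2 * c + (rotationPow c s n).1 * s)

lemma commute_rotationPow {c s x : A} (hc : Commute x c) (hs : Commute x s) (n : ℕ) :
    Commute x (rotationPow c s n).1 ∧ Commute x (rotationPow c s n).2 := by
  induction n with
  | zero => exact ⟨Commute.one_right x, Commute.zero_right x⟩
  | succ n ih =>
    exact ⟨(ih.1.mul_right hc).sub_right (ih.2.mul_right hs),
      (ih.2.mul_right hc).add_right (ih.1.mul_right hs)⟩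

lemma rotationPow_commute {c s : A} (hcs : Commute c s) (n : ℕ) :
    Commute (rotationPow c s n).1 (rotationPow c s n).2 :=
  (commute_rotationPow (commute_rotationPow (Commute.refl c) hcs n).1.symm
    (commute_rotationPow hcs.symm (Commute.refl s) n).1.symm n).2

lemma rotationPow_mul_self_add {c s : A} (hcs : Commute c s) (h1 : c * c + s * s = 1) (n : ℕ) :
    (rotationPow c s n).1 * (rotationPow c s n).1 + (rotationPow c s n).2 * (rotationPow c s n).2
      = 1 := by
  induction n with
  | zero => simp [rotationPow]
  | succ n ih =>
    obtain ⟨hcc, hcd⟩ := commute_rotationPow (Commute.refl c) hcs n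
    obtain ⟨hsc, hsd⟩ := commute_rotationPow hcs.symm (Commute.refl s) n
    have hCD := rotationPow_commute hcs n
    simp only [rotationPow]
    generalize (rotationPow c s n).1 = C at *
    generalize (rotationPow c s n).2 = D at *
    have e : ∀ x y z w : A, Commute y z → x * y * (z * w) = x * z * (y * w) := fun x y z w h ↦ by
      rw [mul_assoc, ← mul_assoc y, h.eq, mul_assoc, mul_assoc]
    calc (C * c - D * s) * (C * c - D * s) + (D * c + C * s) * (D * c + C * s)
        = C * c * (C * c) - C * c * (D * s) - D * s * (C * c) + D * s * (D * s)
          + (D * c * (D * c) + D * c * (C * s) + C * s * (D * c) + C * s * (C * s)) := by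
          noncomm_ring
      _ = (C * C + D * D) * (c * c + s * s) := by
        rw [e C c C c hcc, e C c D s hcd, e D s C c hsc, e D s D s hsd, e D c D c hcd,
          e D c C s hcc, e C s D c hsd, e C s C s hsc, hcs.eq, hCD.eq]
        noncomm_ring
      _ = 1 := by rw [ih, h1, one_mul]

end Rotation

/-! ### Vanishing on idempotents, corners and power-bounded elements -/

namespace IsJordanLeftDerivation

section Algebraic

variable {A : Type*} [Ring A] {δ : A →+ A} (hδ : IsJordanLeftDerivation δ)
include hδ

lemma map_idempotent {e : A} (he : e * e = e) : δ e = 0 := by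
  have h := hδ.map_mul_self e
  rw [he] at h
  have h1 : e * δ e = 2 * (e * δ e) := by
    calc e * δ e = e * (2 * e * δ e) := by rw [← h]
      _ = 2 * (e * e * δ e) := by noncomm_ring
      _ = _ := by rw [he]
  have h2 : e * δ e = 0 := by linear_combination (norm := noncomm_ring) -h1
  rw [h, mul_assoc, h2, mul_zero]

/-- Since `y = p * y + y * p` and `δ p = 0`, one has `δ y = 2 * p * δ y`; multiplying by `p` gives
`p * δ y = 0`. -/
lemma map_eq_zero_of_mul_eq {p y : A} (hp : p * p = p) (h1 : p * y = y) (h2 : y * p = 0) :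
    δ y = 0 := by
  have h := hδ.map_mul_add_mul p y
  rw [h1, h2, add_zero, hδ.map_idempotent hp, mul_zero, add_zero] at h
  have h3 : p * δ y = 2 * (p * δ y) := by
    calc p * δ y = p * (2 * p * δ y) := by rw [← h]
      _ = 2 * (p * p * δ y) := by noncomm_ring
      _ = _ := by rw [hp]
  have h4 : p * δ y = 0 := by linear_combination (norm := noncomm_ring) -h3
  rw [h, mul_assoc, h4, mul_zero]

variable [Algebra ℝ A]

lemma map_idempotent_mul_mul {e : A} (he : e * e = e) (x : A) : δ (e * x * e) = e * δ x := by
  rw [hδ.map_mul_mul, hδ.map_idempotent he, he]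
  simp

/-- If `p` is an idempotent with `A p = p A p`, then the values of a Jordan left derivation are
annihilated by `p A (1 - p)`. -/
lemma mul_mul_one_sub_mul_map {p : A} (hp : p * p = p) (hinv : ∀ x, p * x * p = x * p) (t x : A) :
    p * t * (1 - p) * δ x = 0 := by
  have hq : (1 - p) * p = 0 := by rw [sub_mul, one_mul, hp, sub_self]
  -- For `z = p * t * (1 - p)`, also `x * z` and `z * x` are strictly upper triangular with respect
  -- to `p`, so `δ` kills all three and `2 * z * δ x = 0` remains.
  have hz : δ (p * t * (1 - p)) = 0 := hδ.map_eq_zero_of_mul_eq hp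
    (by rw [← mul_assoc, ← mul_assoc, hp]) (by rw [mul_assoc, hq, mul_zero])
  have hxz : δ (x * (p * t * (1 - p))) = 0 := hδ.map_eq_zero_of_mul_eq hp
    (by
      calc _ = p * x * p * (t * (1 - p)) := by noncomm_ring
        _ = _ := by rw [hinv]; noncomm_ring)
    (by
      calc _ = x * (p * t * ((1 - p) * p)) := by noncomm_ring
        _ = _ := by rw [hq]; simp)
  have hzx : δ (p * t * (1 - p) * x) = 0 := hδ.map_eq_zero_of_mul_eq hp
    (by
      calc _ = p * p * (t * (1 - p) * x) := by noncomm_ring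
        _ = _ := by rw [hp]; noncomm_ring)
    (by
      calc _ = p * t * (1 - p) * (x * p) := by noncomm_ring
        _ = p * t * (1 - p) * (p * x * p) := by rw [hinv]
        _ = p * t * ((1 - p) * p) * (x * p) := by noncomm_ring
        _ = _ := by rw [hq]; simp)
  have h := hδ.map_mul_add_mul x (p * t * (1 - p))
  rw [map_add, hxz, hzx, hz, mul_zero, add_zero, zero_add] at h
  refine eq_zero_of_two_mul ?_
  rw [← mul_assoc]
  exact h.symm

lemma map_eq_zero_of_mul_eq_one {u v : A} (huv : u * v = 1) (hvu : v * u = 1) (hv : δ v = 0) :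
    δ u = 0 := by
  have h := hδ.map_mul_of_commute (show Commute u v from huv.trans hvu.symm)
  rw [huv, hδ.map_one, hv, mul_zero, zero_add] at h
  rw [← one_mul (δ u), ← huv, mul_assoc, ← h, mul_zero]

end Algebraic

section Normed

variable {A : Type*} [NormedRing A] [NormedAlgebra ℝ A] {δ : A →L[ℝ] A}
  (hδ : IsJordanLeftDerivation (δ : A →+ A))
include hδ

lemma map_eq_zero_of_norm_pow_le {u v : A} (huv : v * u = 1) (hu : ∀ n, ‖u ^ n‖ ≤ 1)
    (hv : ∀ n, ‖v ^ n‖ ≤ 1) : δ u = 0 := by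
  have hpow : ∀ n, v ^ n * u ^ n = 1 := fun n ↦ by
    induction n with
    | zero => simp
    | succ n ih =>
      rw [pow_succ, pow_succ', mul_assoc, ← mul_assoc v, huv, one_mul, ih]
  have h : ∀ n : ℕ, ((n : ℝ) + 1) * ‖δ u‖ ≤ ‖δ‖ := fun n ↦ by
    have h1 : δ (u ^ (n + 1)) = (n + 1) * u ^ n * δ u := hδ.map_pow_succ u n
    have h2 : v ^ n * δ (u ^ (n + 1)) = ((n : ℝ) + 1) • δ u := by
      have : v ^ n * ((n : A) + 1) = (n + 1) * v ^ n := by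
        rw [mul_add, add_mul, (Nat.cast_commute n (v ^ n)).eq, one_mul, mul_one]
      rw [h1, ← mul_assoc, ← mul_assoc, this, mul_assoc _ (v ^ n), hpow, mul_one, Algebra.smul_def]
      simp
    calc ((n : ℝ) + 1) * ‖δ u‖ = ‖v ^ n * δ (u ^ (n + 1))‖ := by
          rw [h2, norm_smul, Real.norm_of_nonneg (by positivity)]
      _ ≤ ‖v ^ n‖ * (‖δ‖ * ‖u ^ (n + 1)‖) :=
        (norm_mul_le _ _).trans (by gcongr; exact δ.le_opNorm _)
      _ ≤ 1 * (‖δ‖ * 1) := by gcongr; exacts [hv n, hu (n + 1)]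
      _ = ‖δ‖ := by ring
  by_contra hne
  have hpos : 0 < ‖δ u‖ := norm_pos_iff.2 hne
  obtain ⟨n, hn⟩ := exists_nat_gt (‖δ‖ / ‖δ u‖)
  rw [div_lt_iff₀ hpos] at hn
  linarith [h n]

/-- Think of `c = cos θ`, `s = sin θ`; then `g` plays the role of `δ θ`. The multiple angle formulas
write `n • g` as an expression bounded by `2 * ‖δ‖` for every `n`, so `g = 0`. -/
lemma map_eq_zero_of_rotationPow_norm_le {c s : A} (hcs : Commute c s)
    (h1 : c * c + s * s = 1) (hc : ∀ n, ‖(rotationPow c s n).1‖ ≤ 1)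
    (hs : ∀ n, ‖(rotationPow c s n).2‖ ≤ 1) : δ c = 0 := by
  have hone : δ 1 = 0 := hδ.map_one
  have hmul : ∀ {x y}, Commute x y → δ (x * y) = x * δ y + y * δ x := hδ.map_mul_of_commute
  obtain ⟨g, hg⟩ : ∃ g, g = c * δ s - s * δ c := ⟨_, rfl⟩
  have h2 : c * δ c + s * δ s = 0 := by
    refine eq_zero_of_two_mul ?_
    have := congrArg δ h1
    rw [map_add, hmul (Commute.refl c), hmul (Commute.refl s), hone] at this
    linear_combination (norm := noncomm_ring) this
  have hδs : δ s = c * g := by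
    have e1 : s * (c * δ c + s * δ s) = 0 := by rw [h2, mul_zero]
    have e2 : (c * c + s * s) * δ s = δ s := by rw [h1, one_mul]
    have e3 : c * s * δ c = s * c * δ c := by rw [hcs.eq]
    rw [hg]
    linear_combination (norm := noncomm_ring) e1 - e2 + e3
  have hδc : δ c = -(s * g) := by
    have e1 : c * (c * δ c + s * δ s) = 0 := by rw [h2, mul_zero]
    have e2 : (c * c + s * s) * δ c = δ c := by rw [h1, one_mul]
    have e3 : c * s * δ s = s * c * δ s := by rw [hcs.eq]
    rw [hg]
    linear_combination (norm := noncomm_ring) e1 - e2 - e3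
  have hrot : ∀ n : ℕ, δ (rotationPow c s n).1 = -((n : ℝ) • ((rotationPow c s n).2 * g)) ∧
      δ (rotationPow c s n).2 = (n : ℝ) • ((rotationPow c s n).1 * g) := fun n ↦ by
    induction n with
    | zero => simp [rotationPow, hone]
    | succ n ih =>
      obtain ⟨hcc, hcs'⟩ := commute_rotationPow (Commute.refl c) hcs n
      obtain ⟨hsc, hss⟩ := commute_rotationPow hcs.symm (Commute.refl s) n
      simp only [rotationPow, map_add, map_sub]
      rw [hmul hcc.symm, hmul hcs'.symm, hmul hss.symm, hmul hsc.symm, ih.1, ih.2, hδc, hδs]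
      simp only [mul_neg, mul_smul_comm, ← mul_assoc, hcc.eq, hcs'.eq, hsc.eq, hss.eq]
      push_cast
      simp only [add_mul, sub_mul]
      constructor <;> module
  have hle : ∀ n : ℕ, (n : ℝ) * ‖g‖ ≤ 2 * ‖δ‖ := fun n ↦ by
    have e : (n : ℝ) • g = (rotationPow c s n).1 * δ (rotationPow c s n).2
        - (rotationPow c s n).2 * δ (rotationPow c s n).1 := by
      rw [(hrot n).1, (hrot n).2, mul_neg, mul_smul_comm, mul_smul_comm, sub_neg_eq_add, ← smul_add,
        ← mul_assoc, ← mul_assoc, ← add_mul, rotationPow_mul_self_add hcs h1, one_mul]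
    have hb : ∀ x y : A, ‖x‖ ≤ 1 → ‖y‖ ≤ 1 → ‖x * δ y‖ ≤ ‖δ‖ := fun x y hx hy ↦ by
      calc ‖x * δ y‖ ≤ ‖x‖ * (‖δ‖ * ‖y‖) :=
            (norm_mul_le _ _).trans (by gcongr; exact δ.le_opNorm _)
        _ ≤ 1 * (‖δ‖ * 1) := by gcongr
        _ = ‖δ‖ := by ring
    calc (n : ℝ) * ‖g‖ = ‖(n : ℝ) • g‖ := by rw [norm_smul, Real.norm_natCast]
      _ ≤ ‖δ‖ + ‖δ‖ := by
        rw [e]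
        exact (norm_sub_le _ _).trans (add_le_add (hb _ _ (hc n) (hs n)) (hb _ _ (hs n) (hc n)))
      _ = _ := by ring
  have hg0 : g = 0 := by
    by_contra hne
    have hpos : 0 < ‖g‖ := norm_pos_iff.2 hne
    obtain ⟨n, hn⟩ := exists_nat_gt (2 * ‖δ‖ / ‖g‖)
    rw [div_lt_iff₀ hpos] at hn
    linarith [hle n]
  rw [hδc, hg0, mul_zero, neg_zero]

end Normed

end IsJordanLeftDerivation

/-! ### Norm estimates for Hilbert space operators -/

section Operators

variable {𝕜 H : Type*} [RCLike 𝕜] [NormedAddCommGroup H] [InnerProductSpace 𝕜 H] [CompleteSpace H]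

/-- The Cayley transform of a skew-adjoint `k` is isometric: `⟪y, k y⟫` has real part `0`, so `1 +
k` and `1 - k` stretch `y` equally. -/
lemma ContinuousLinearMap.norm_apply_of_mul_one_sub_eq {k T v : H →L[𝕜] H} (hk : star k = -k)
    (hT : T * (1 - k) = 1 + k) (hv : (1 - k) * v = 1) (x : H) : ‖T x‖ = ‖x‖ := by
  have hre : ∀ y : H, RCLike.re (inner 𝕜 y (k y)) = 0 := fun y ↦ by
    have h1 : inner 𝕜 (k y) y = inner 𝕜 y ((-k) y) := by
      rw [← hk, star_eq_adjoint, adjoint_inner_right]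
    rw [neg_apply, inner_neg_right] at h1
    have h2 := inner_re_symm (𝕜 := 𝕜) (k y) y
    rw [h1, map_neg] at h2
    linarith
  have hx : x = (1 - k) (v x) := by
    rw [← mul_apply_eq_comp, hv, one_apply_eq_self]
  have hTx : T x = (1 + k) (v x) := by
    rw [← hT, mul_apply_eq_comp, ← hx]
  have h : ‖T x‖ ^ 2 = ‖x‖ ^ 2 := by
    rw [hTx]
    conv_rhs => rw [hx]
    rw [add_apply, sub_apply, one_apply_eq_self, norm_add_sq (𝕜 := 𝕜), norm_sub_sq (𝕜 := 𝕜), hre]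
    ring
  exact (sq_eq_sq₀ (norm_nonneg _) (norm_nonneg _)).1 h

omit [CompleteSpace H] in
lemma ContinuousLinearMap.norm_pow_le_one_of_norm_apply {T : H →L[𝕜] H} (hT : ∀ x, ‖T x‖ = ‖x‖)
    (n : ℕ) : ‖T ^ n‖ ≤ 1 := by
  have h : ∀ x, ‖(T ^ n) x‖ = ‖x‖ := by
    induction n with
    | zero => simp
    | succ n ih => intro x; rw [pow_succ, mul_apply_eq_comp, ih, hT]
  exact opNorm_le_bound _ zero_le_one fun x ↦ by rw [h, one_mul]

lemma IsSelfAdjoint.norm_le_one_of_mul_self_add_mul_self {a b : H →L[𝕜] H} (ha : IsSelfAdjoint a)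
    (hb : IsSelfAdjoint b) (h : a * a + b * b = 1) : ‖a‖ ≤ 1 := by
  refine ContinuousLinearMap.opNorm_le_bound _ zero_le_one fun x ↦ ?_
  have hsq : ∀ {c : H →L[𝕜] H}, IsSelfAdjoint c → RCLike.re (inner 𝕜 ((c * c) x) x) = ‖c x‖ ^ 2 := by
    intro c hc
    rw [mul_apply_eq_comp, ← ContinuousLinearMap.adjoint_inner_right,
      ← ContinuousLinearMap.star_eq_adjoint, hc.star_eq, inner_self_eq_norm_sq]
  have h1 : ‖a x‖ ^ 2 + ‖b x‖ ^ 2 = ‖x‖ ^ 2 := by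
    rw [← hsq ha, ← hsq hb, ← map_add, ← inner_add_left, ← add_apply, h,
      one_apply_eq_self, inner_self_eq_norm_sq]
  rw [one_mul]
  exact (sq_le_sq₀ (norm_nonneg _) (norm_nonneg _)).1 (by nlinarith [sq_nonneg ‖b x‖])

end Operators

/-! ### CSL algebras -/

section OperatorAlgebra

variable {𝕜 H : Type*} [RCLike 𝕜] [NormedAddCommGroup H] [InnerProductSpace 𝕜 H]

lemma mem_latticeAlg {L : Set (ClosedSubmodule 𝕜 H)} {T : H →L[𝕜] H} :
    T ∈ latticeAlg L ↔ ∀ M ∈ L, ∀ x ∈ M, T x ∈ M := Iff.rfl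

lemma isClosed_latticeAlg (L : Set (ClosedSubmodule 𝕜 H)) :
    IsClosed (latticeAlg L : Set (H →L[𝕜] H)) := by
  have : (latticeAlg L : Set (H →L[𝕜] H)) = ⋂ M ∈ L, ⋂ x ∈ M, {T | T x ∈ (M : Set H)} := by
    ext T
    simp [mem_latticeAlg]
  rw [this]
  refine isClosed_biInter fun M _ ↦ isClosed_biInter fun x _ ↦ ?_
  exact M.isClosed.preimage (ContinuousLinearMap.apply 𝕜 H x).continuous

/-- An isometric representation of a real normed algebra by bounded operators on a real or complex
Hilbert space. -/
structure IsIsometricRep {A : Type*} [NormedRing A] [NormedAlgebra ℝ A]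
    (ι : A →+* (H →L[𝕜] H)) : Prop where
  norm_apply : ∀ x, ‖ι x‖ = ‖x‖
  map_smul : ∀ (t : ℝ) x, ι (t • x) = (t : 𝕜) • ι x

lemma IsIsometricRep.injective {A : Type*} [NormedRing A] [NormedAlgebra ℝ A]
    {ι : A →+* (H →L[𝕜] H)} (hι : IsIsometricRep ι) : Function.Injective ι :=
  (injective_iff_map_eq_zero ι).2 fun x hx ↦ by rw [← norm_eq_zero, ← hι.norm_apply, hx, norm_zero]

variable [CompleteSpace H] {A : Type*} [NormedRing A] [NormedAlgebra ℝ A] [CompleteSpace A]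
  {ι : A →+* (H →L[𝕜] H)} (hι : IsIsometricRep ι)

namespace IsJordanLeftDerivation

variable {δ : A →L[ℝ] A}
  (hδ : IsJordanLeftDerivation (δ : A →+ A))
include hι hδ

/-- For `‖k‖ < 1` the Cayley transform and its inverse exist in `A` and have contractive powers, so
`δ` kills the transform. It equals `2 (1 - k)⁻¹ - 1`, so `δ` also kills `(1 - k)⁻¹`, `1 - k` and
`k`. -/
lemma map_eq_zero_of_star_eq_neg {k : A} (hk : star (ι k) = -ι k) :
    δ k = 0 := by
  have hδ1 : δ 1 = 0 := hδ.map_one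
  have key : ∀ k : A, star (ι k) = -ι k → ‖k‖ < 1 → δ k = 0 := by
    intro k hk hlt
    have hlt' : ‖-k‖ < 1 := by rwa [norm_neg]
    obtain ⟨v, hv⟩ : ∃ v : (A)ˣ, (v : A) = 1 - k := ⟨Units.oneSub k hlt, rfl⟩
    obtain ⟨w, hw⟩ : ∃ w : (A)ˣ, (w : A) = 1 + k :=
      ⟨Units.oneSub (-k) hlt', by rw [Units.val_oneSub, sub_neg_eq_add]⟩
    have hvw : (w : A) * v = v * w := by rw [hv, hw]; noncomm_ring
    have h1 : (↑v⁻¹ * w : A) * (1 - k) = 1 + k := by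
      rw [← hv, mul_assoc, hvw, ← mul_assoc, Units.inv_mul, one_mul, hw]
    have h2 : (↑w⁻¹ * v : A) * (1 - -k) = 1 + -k := by
      rw [sub_neg_eq_add, ← hw, mul_assoc, ← hvw, ← mul_assoc, Units.inv_mul, one_mul, hv,
        sub_eq_add_neg]
    have h3 : (1 - k) * (↑v⁻¹ : A) = 1 := by rw [← hv, Units.mul_inv]
    have h4 : (1 - -k) * (↑w⁻¹ : A) = 1 := by
      rw [sub_neg_eq_add, ← hw, Units.mul_inv]
    have hu : δ (↑v⁻¹ * w : A) = 0 := by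
      refine hδ.map_eq_zero_of_norm_pow_le (v := (↑w⁻¹ * v : A)) ?_ (fun n ↦ ?_)
        fun n ↦ ?_
      · rw [mul_assoc, ← mul_assoc (v : A), Units.mul_inv, one_mul, Units.inv_mul]
      · rw [← hι.norm_apply, map_pow]
        exact ContinuousLinearMap.norm_pow_le_one_of_norm_apply
          (ContinuousLinearMap.norm_apply_of_mul_one_sub_eq hk
            (by simpa using congrArg ι h1) (by simpa using congrArg ι h3)) n
      · rw [← hι.norm_apply, map_pow]
        exact ContinuousLinearMap.norm_pow_le_one_of_norm_apply
          (ContinuousLinearMap.norm_apply_of_mul_one_sub_eq (k := ι (-k))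
            (by simp [hk]) (by simpa using congrArg ι h2) (by simpa using congrArg ι h4)) n
    have h5 : (↑v⁻¹ * w : A) = ↑v⁻¹ + ↑v⁻¹ - 1 := by
      have : (w : A) = 1 + 1 - v := by rw [hv, hw]; abel
      rw [this, mul_sub, mul_add, mul_one, Units.inv_mul]
    have h6 : δ (↑v⁻¹ : A) = 0 := by
      rw [h5, map_sub, map_add, hδ1, sub_zero, ← two_mul] at hu
      exact eq_zero_of_two_mul hu
    have h7 : δ (v : A) = 0 :=
      hδ.map_eq_zero_of_mul_eq_one v.mul_inv v.inv_mul h6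
    rwa [hv, map_sub, hδ1, zero_sub, neg_eq_zero] at h7
  have ht : (‖k‖ + 1)⁻¹ ≠ 0 := by positivity
  have := key ((‖k‖ + 1)⁻¹ • k) (by rw [hι.map_smul, star_smul, hk]; simp) (by
    rw [norm_smul, Real.norm_of_nonneg (by positivity), inv_mul_lt_iff₀ (by positivity)]
    linarith)
  rw [map_smul] at this
  exact (smul_eq_zero.1 this).resolve_left ht

/-- With no `i` to make `h` skew-adjoint, the real part `c = 2 (1 + h²)⁻¹ - 1` and the imaginary
part `s = 2 h (1 + h²)⁻¹` of the Cayley transform of `i h` are used. This gives `δ (h * h) = 0`, and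
passing to `h + 1` gives `δ h = 0`. -/
lemma map_eq_zero_of_isSelfAdjoint {h : A} (hh : IsSelfAdjoint (ι h)) :
    δ h = 0 := by
  have hδ1 : δ 1 = 0 := hδ.map_one
  have key : ∀ h : A, IsSelfAdjoint (ι h) → ‖h * h‖ < 1 → δ (h * h) = 0 := by
    intro h hh hlt
    have hlt' : ‖-(h * h)‖ < 1 := by rwa [norm_neg]
    obtain ⟨v, hv⟩ : ∃ v : (A)ˣ, (v : A) = 1 + h * h :=
      ⟨Units.oneSub (-(h * h)) hlt', by rw [Units.val_oneSub, sub_neg_eq_add]⟩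
    obtain ⟨r, hr⟩ : ∃ r : A, r = ↑v⁻¹ := ⟨_, rfl⟩
    have hrv : r * (1 + h * h) = 1 := by rw [hr, ← hv, Units.inv_mul]
    have hvr : (1 + h * h) * r = 1 := by rw [hr, ← hv, Units.mul_inv]
    have hhr : Commute h r := by
      rw [hr]
      refine Commute.units_inv_right ?_
      rw [hv]
      exact (Commute.one_right h).add_right ((Commute.refl h).mul_right (Commute.refl h))
    have hrsa : IsSelfAdjoint (ι r) := by
      have h1 : (ι r) * (1 + ι h * ι h) = 1 := by
        simpa using congrArg ι hrv
      have h2 : (1 + ι h * ι h) * star (ι r) = 1 := by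
        have := congrArg star h1
        rwa [star_mul, star_one, star_add, star_one, star_mul, hh.star_eq] at this
      exact (left_inv_eq_right_inv h1 h2).symm
    obtain ⟨c, hc⟩ : ∃ c, c = r + r - 1 := ⟨_, rfl⟩
    obtain ⟨s, hs⟩ : ∃ s, s = h * r + h * r := ⟨_, rfl⟩
    have hcs : Commute c s := by
      have : Commute r (h * r) := hhr.symm.mul_right (Commute.refl r)
      rw [hc, hs]
      exact ((this.add_left this).sub_left (Commute.one_left _)).add_right
        ((this.add_left this).sub_left (Commute.one_left _))
    have h1 : c * c + s * s = 1 := by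
      have e1 : h * r * (h * r) = r * (h * h) * r := by
        rw [← mul_assoc, mul_assoc h r h, ← hhr.eq, ← mul_assoc, (hhr.mul_left hhr).eq]
      have e2 : r * (1 + h * h) * r = r := by rw [hrv, one_mul]
      rw [hc, hs]
      linear_combination (norm := noncomm_ring) 4 * e1 + 4 * e2
    have hcsa : IsSelfAdjoint (ι c) := by
      rw [hc, map_sub, map_add, _root_.map_one]
      exact (hrsa.add hrsa).sub (IsSelfAdjoint.one _)
    have hssa : IsSelfAdjoint (ι s) := by
      have : IsSelfAdjoint (ι h * ι r) :=
        (hh.commute_iff hrsa).1 (hhr.map ι)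
      rw [hs, map_add, map_mul]
      exact this.add this
    have hmul : ∀ {a b : A}, Commute a b → IsSelfAdjoint (ι a) →
        IsSelfAdjoint (ι b) → IsSelfAdjoint (ι (a * b)) :=
      fun {a b} hab ha hb ↦ by
      rw [map_mul]
      exact (ha.commute_iff hb).1 (hab.map ι)
    have hsa : ∀ n, IsSelfAdjoint (ι (rotationPow c s n).1) ∧
        IsSelfAdjoint (ι (rotationPow c s n).2) := fun n ↦ by
      induction n with
      | zero =>
        simp only [rotationPow, _root_.map_one, _root_.map_zero]
        exact ⟨IsSelfAdjoint.one _, IsSelfAdjoint.zero _⟩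
      | succ n ih =>
        have hcr := commute_rotationPow (Commute.refl c) hcs n
        have hsr := commute_rotationPow hcs.symm (Commute.refl s) n
        simp only [rotationPow, map_sub, map_add]
        exact ⟨(hmul hcr.1.symm ih.1 hcsa).sub (hmul hsr.2.symm ih.2 hssa),
          (hmul hcr.2.symm ih.2 hcsa).add (hmul hsr.1.symm ih.1 hssa)⟩
    have hsum : ∀ n, ι (rotationPow c s n).1 * ι (rotationPow c s n).1
        + ι (rotationPow c s n).2 * ι (rotationPow c s n).2 = 1 := fun n ↦ by
      simpa using congrArg ι (rotationPow_mul_self_add hcs h1 n)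
    have hδc := hδ.map_eq_zero_of_rotationPow_norm_le hcs h1
      (fun n ↦ hι.norm_apply _ ▸
        (hsa n).1.norm_le_one_of_mul_self_add_mul_self (hsa n).2 (hsum n))
      (fun n ↦ hι.norm_apply _ ▸
        (hsa n).2.norm_le_one_of_mul_self_add_mul_self (hsa n).1 (by rw [add_comm]; exact hsum n))
    rw [hc, map_sub, map_add, hδ1, sub_zero, ← two_mul] at hδc
    have h2 : δ (1 + h * h) = 0 :=
      hδ.map_eq_zero_of_mul_eq_one hvr hrv (eq_zero_of_two_mul hδc)
    rwa [map_add, hδ1, zero_add] at h2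
  have hsmul : ∀ (t : ℝ) {h : A}, IsSelfAdjoint (ι h) →
      IsSelfAdjoint (ι (t • h)) := fun t h hh ↦ by
    rw [hι.map_smul]
    exact IsSelfAdjoint.smul (by simp [IsSelfAdjoint]) hh
  have hsq : ∀ h : A, IsSelfAdjoint (ι h) → δ (h * h) = 0 := by
    intro h hh
    have ht : (‖h‖ + 1)⁻¹ ≠ 0 := by positivity
    have hlt : ‖(‖h‖ + 1)⁻¹ • h‖ < 1 := by
      rw [norm_smul, Real.norm_of_nonneg (by positivity), inv_mul_lt_iff₀ (by positivity)]
      linarith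
    have := key ((‖h‖ + 1)⁻¹ • h) (hsmul _ hh)
      ((norm_mul_le _ _).trans_lt (mul_lt_one_of_nonneg_of_lt_one_left (norm_nonneg _) hlt hlt.le))
    rw [smul_mul_smul_comm, map_smul] at this
    exact (smul_eq_zero.1 this).resolve_left (mul_ne_zero ht ht)
  have h1 := hsq (h + 1) (by
    rw [map_add, _root_.map_one]
    exact hh.add (IsSelfAdjoint.one _))
  have h2 : (h + 1) * (h + 1) = h * h + (h + h) + 1 := by noncomm_ring
  rw [h2, map_add, map_add, hsq h hh, hδ1, zero_add, add_zero, map_add, ← two_mul] at h1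
  exact eq_zero_of_two_mul h1

lemma map_eq_zero_of_star_mem_range {x : A} (hx : star (ι x) ∈ ι.range) : δ x = 0 := by
  obtain ⟨y, hy⟩ := hx
  have h1 : δ (x + y) = 0 := hδ.map_eq_zero_of_isSelfAdjoint hι (by
    rw [map_add, hy]
    exact IsSelfAdjoint.add_star_self _)
  have h2 : δ (x - y) = 0 := hδ.map_eq_zero_of_star_eq_neg hι (by
    rw [map_sub, hy, star_sub, star_star, neg_sub])
  have h3 : x + x = (x + y) + (x - y) := by abel
  refine eq_zero_of_two_mul ?_
  rw [two_mul, ← map_add, h3, map_add, h1, h2, add_zero]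

/-- A continuous Jordan left derivation of a CSL algebra is zero. -/
theorem eq_zero_of_isCSL {L : Set (ClosedSubmodule 𝕜 H)} (hL : IsCSL L)
    (hr : ∀ T, T ∈ latticeAlg L ↔ T ∈ ι.range) : δ = 0 := by
  ext x
  have hmem : ∀ T : H →L[𝕜] H, (∀ M ∈ L, Commute T M.toSubmodule.starProjection) →
      T ∈ latticeAlg L := fun T hT M hM y hy ↦ by
    have h1 : M.toSubmodule.starProjection y = y :=
      Submodule.starProjection_eq_self_iff.2 hy
    have h2 := congrArg (fun S : H →L[𝕜] H ↦ S y) (hT M hM).eq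
    simp only [mul_apply_eq_comp, h1] at h2
    change T y ∈ M.toSubmodule
    rw [h2]
    exact Submodule.starProjection_apply_mem _ _
  have hPmem : ∀ M ∈ L, M.toSubmodule.starProjection ∈ latticeAlg L := fun M hM ↦
    hmem _ fun N hN ↦ hL.commute M hM N hN
  have hPP : ∀ M : ClosedSubmodule 𝕜 H, M.toSubmodule.starProjection
      * M.toSubmodule.starProjection = M.toSubmodule.starProjection := fun M ↦
    Submodule.isIdempotentElem_starProjection _
  have hinv : ∀ M ∈ L, ∀ T ∈ latticeAlg L, M.toSubmodule.starProjection * T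
      * M.toSubmodule.starProjection = T * M.toSubmodule.starProjection := fun M hM T hT ↦ by
    ext y
    exact Submodule.starProjection_eq_self_iff.2
      (hT M hM _ (Submodule.starProjection_apply_mem M.toSubmodule y))
  -- the joint kernel of the operators `P T (1 - P)`
  obtain ⟨K, hK⟩ : ∃ K : Submodule 𝕜 H, ∀ y, y ∈ K ↔ ∀ M ∈ L, ∀ T ∈ latticeAlg L,
      (M.toSubmodule.starProjection * T * (1 - M.toSubmodule.starProjection)) y = 0 :=
    ⟨⨅ M ∈ L, ⨅ T ∈ latticeAlg L, LinearMap.ker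
      (M.toSubmodule.starProjection * T * (1 - M.toSubmodule.starProjection)).toLinearMap,
      fun y ↦ by simp [Submodule.mem_iInf]⟩
  have hKc : IsClosed (K : Set H) := by
    have : (K : Set H) = ⋂ M ∈ L, ⋂ T ∈ latticeAlg L, {y |
      (M.toSubmodule.starProjection * T * (1 - M.toSubmodule.starProjection)) y = 0} := by
      ext y
      simp only [SetLike.mem_coe, hK, Set.mem_iInter, Set.mem_ofPred_eq]
    rw [this]
    refine isClosed_biInter fun M _ ↦ isClosed_biInter fun T _ ↦ ?_
    exact isClosed_eq (ContinuousLinearMap.continuous _) continuous_const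
  have : CompleteSpace K := hKc.completeSpace_coe
  have hE : K.starProjection * K.starProjection = K.starProjection :=
    Submodule.isIdempotentElem_starProjection _
  have hKE : ∀ M ∈ L, ∀ T ∈ latticeAlg L, M.toSubmodule.starProjection * T
      * (1 - M.toSubmodule.starProjection) * K.starProjection = 0 := fun M hM T hT ↦ by
    ext y
    exact (hK _).1 (Submodule.starProjection_apply_mem _ _) M hM T hT
  -- `K` is invariant under each projection `P` of the lattice, since `T P` is again in the algebra
  -- and the projections commute; taking adjoints turns invariance into commutation.
  have hEP : ∀ M ∈ L, Commute K.starProjection M.toSubmodule.starProjection := fun M hM ↦ by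
    have h1 : K.starProjection * (M.toSubmodule.starProjection * K.starProjection)
        = M.toSubmodule.starProjection * K.starProjection := by
      ext y
      refine Submodule.starProjection_eq_self_iff.2 ((hK _).2 fun N hN T hT ↦ ?_)
      have h2 := hKE N hN (T * M.toSubmodule.starProjection) (mul_mem hT (hPmem M hM))
      have h3 : N.toSubmodule.starProjection * T * (1 - N.toSubmodule.starProjection)
          * (M.toSubmodule.starProjection * K.starProjection) = 0 := by
        rw [← h2]
        have h4 := (hL.commute M hM N hN).eq
        simp only [mul_sub, sub_mul, mul_one, mul_assoc]
        rw [← mul_assoc M.toSubmodule.starProjection N.toSubmodule.starProjection, h4, mul_assoc]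
      exact congrArg (fun S : H →L[𝕜] H ↦ S y) h3
    have h2 := congrArg star h1
    rw [star_mul, star_mul, (isSelfAdjoint_starProjection K).star_eq,
      (isSelfAdjoint_starProjection M.toSubmodule).star_eq, mul_assoc, h1] at h2
    exact h2.symm
  obtain ⟨e, he⟩ := (hr _).1 (hmem _ hEP)
  have hee : e * e = e := hι.injective (by rw [map_mul, he, hE])
  have h1 : e * δ x = δ x := by
    refine hι.injective (ContinuousLinearMap.ext fun y ↦ ?_)
    rw [map_mul, he]
    refine Submodule.starProjection_eq_self_iff.2 ((hK _).2 fun M hM T hT ↦ ?_)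
    obtain ⟨p, hp⟩ := (hr _).1 (hPmem M hM)
    obtain ⟨t, rfl⟩ := (hr _).1 hT
    have h2 : p * t * (1 - p) * δ x = 0 := hδ.mul_mul_one_sub_mul_map (p := p)
      (hι.injective (by rw [map_mul, hp, hPP]))
      (fun S ↦ hι.injective (by
        rw [map_mul, map_mul, map_mul, hp, hinv M hM _ ((hr _).2 ⟨S, rfl⟩)])) t x
    have h3 := congrArg (fun S : H →L[𝕜] H ↦ S y) (congrArg ι h2)
    rw [map_mul, map_mul, map_mul, map_sub, _root_.map_one, hp, _root_.map_zero] at h3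
    exact h3
  have h2 : δ (e * x * e) = e * δ x := hδ.map_idempotent_mul_mul hee x
  -- On `K` the corner `P x (1 - P)` vanishes, so `P x E = P x P E = x P E`.
  have h3 : ∀ M ∈ L, Commute (ι (e * x * e)) M.toSubmodule.starProjection := fun M hM ↦ by
    have hx := (hr _).2 ⟨x, rfl⟩
    have h4 := hKE M hM _ hx
    have h5 := hinv M hM _ hx
    have h6 := (hEP M hM).eq
    rw [map_mul, map_mul, he]
    generalize M.toSubmodule.starProjection = P at *
    generalize K.starProjection = E at *
    have h7 : P * ι x * E = ι x * P * E := by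
      rw [← h5, ← sub_eq_zero, ← h4]
      simp only [mul_sub, sub_mul, mul_one]
    calc E * ι x * E * P = E * (ι x * P * E) := by
          rw [mul_assoc (E * ι x), h6, mul_assoc, mul_assoc (ι x)]
      _ = P * (E * ι x * E) := by
          rw [← h7, ← mul_assoc, ← mul_assoc, h6, mul_assoc, mul_assoc, mul_assoc]
  have h4 : δ (e * x * e) = 0 := hδ.map_eq_zero_of_star_mem_range hι ((hr _).1 (hmem _ fun M hM ↦ by
    have h5 := congrArg star (h3 M hM).eq
    rw [star_mul, star_mul, (isSelfAdjoint_starProjection M.toSubmodule).star_eq] at h5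
    exact h5.symm))
  rw [← h1, ← h2, h4]
  rfl

end IsJordanLeftDerivation

end OperatorAlgebra

/-! ### Reduction to real scalars and conclusion -/

section RestrictScalars

variable {𝕜 A : Type*} [RCLike 𝕜] [NormedRing A] [NormedAlgebra 𝕜 A] [CompleteSpace A]
  {δ : A →L[𝕜] A}

/-- To show that `δ` vanishes it suffices to consider it as a real Jordan left derivation. -/
lemma IsJordanLeftDerivableAtOne.eq_zero_of_forall_real (hδ : IsJordanLeftDerivableAtOne δ)
    (h : letI : NormedAlgebra ℝ A := NormedAlgebra.restrictScalars ℝ 𝕜 A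
      ∀ δ' : A →L[ℝ] A, IsJordanLeftDerivation (δ' : A →+ A) → δ' = 0) : δ = 0 := by
  let : NormedAlgebra ℝ A := NormedAlgebra.restrictScalars ℝ 𝕜 A
  let δ' : A →L[ℝ] A :=
    { toFun := δ
      map_add' := map_add δ
      map_smul' := fun t x ↦ map_smul δ (t : 𝕜) x
      cont := δ.continuous }
  have hδ' : IsJordanLeftDerivableAtOne δ' := hδ
  have h0 := h δ' hδ'.isJordanLeftDerivation
  ext x
  exact congrArg (fun f : A →L[ℝ] A ↦ f x) h0

/-- `A` is an abstract isometric copy of the operator algebra, so its real structure is exactly the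
one obtained by restricting scalars. -/
lemma IsJordanLeftDerivableAtOne.eq_zero_of_isCSL {H : Type*} [NormedAddCommGroup H]
    [InnerProductSpace 𝕜 H] [CompleteSpace H] {L : Set (ClosedSubmodule 𝕜 H)} (hL : IsCSL L)
    (ι : A →ₐ[𝕜] (H →L[𝕜] H)) (hι : ∀ x, ‖ι x‖ = ‖x‖)
    (hr : ∀ T, T ∈ latticeAlg L ↔ ∃ x, ι x = T) (hδ : IsJordanLeftDerivableAtOne δ) : δ = 0 := by
  refine hδ.eq_zero_of_forall_real fun δ' hδ' ↦ ?_
  let : NormedAlgebra ℝ A := NormedAlgebra.restrictScalars ℝ 𝕜 A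
  exact hδ'.eq_zero_of_isCSL (ι := (ι : A →+* (H →L[𝕜] H)))
    ⟨hι, fun t x ↦ map_smul ι (t : 𝕜) x⟩ hL hr

end RestrictScalars

theorem corollary2p4 {𝕜 : Type*} [RCLike 𝕜] :
    (∀ (H : Type*) [NormedAddCommGroup H] [InnerProductSpace 𝕜 H] [CompleteSpace H]
        (L : Set (ClosedSubmodule 𝕜 H)), IsCSL L →
        ∀ δ : latticeAlg L →L[𝕜] latticeAlg L, IsJordanLeftDerivableAtOne δ → δ = 0) ∧
    (∀ (A : Type*) [NormedRing A] [NormedAlgebra 𝕜 A] [CompleteSpace A],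
        Ring.jacobson A = ⊥ →
        ∀ δ : A →L[𝕜] A, IsJordanLeftDerivableAtOne δ → δ = 0) := by
  refine ⟨fun H _ _ _ L hL δ hδ ↦ ?_, fun A _ _ _ hA δ hδ ↦ ?_⟩
  · have : CompleteSpace (latticeAlg L) := (isClosed_latticeAlg L).completeSpace_coe
    exact hδ.eq_zero_of_isCSL hL (latticeAlg L).val (fun _ ↦ rfl)
      fun T ↦ ⟨fun hT ↦ ⟨⟨T, hT⟩, rfl⟩, fun ⟨x, hx⟩ ↦ hx ▸ x.2⟩
  · refine hδ.eq_zero_of_forall_real fun δ' hδ' ↦ ?_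
    let : NormedAlgebra ℝ A := NormedAlgebra.restrictScalars ℝ 𝕜 A
    exact hδ'.eq_zero_of_jacobson_eq_bot hA
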